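/- Let $k,n\in\mathbb{N}$, $d\in\mathbb{N}$, and let $\varepsilon,\delta$ be real numbers with $0<\varepsilon<0.572$ and $0<\delta<1$. Let $\mathbf{\Theta}$ be a random real $k\times n$ matrix that is either - rescaled Gaussian: its entries are independent normal random variables with mean $0$ and variance $k^{-1}$; or - rescaled Rademacher: its entries are independent random variables with $\mathbb{P}([\mathbf{\Theta}]_{i,j}=k^{-1/2})=\mathbb{P}([\mathbf{\Theta}]_{i,j}=-k^{-1/2})=1/2$. For $\mathbb{K}\in\{\mathbb{R},\mathbb{C}\}$, let $\langle\cdot,\cdot\rangle$ and $\|\cdot\|$ denote the canonical $\ell_2$ inner product and norm on $\mathbb{K}^n$ and $\mathbb{K}^k$. Call $\mathbf{\Theta}$ an $(\varepsilon,\delta,d)$ oblivious $\ell_2\to\ell_2$ subspace embedding over $\mathbb{K}$ if for every $d$-dimensional subspace $V$ of $\mathbb{K}^n$, $$\mathbb{P}\Big(\forall\, \mathbf{x},\mathbf{y}\in V:\ \big|\langle \mathbf{x},\mathbf{y}\rangle-\langle\mathbf{\Theta}\mathbf{x},\mathbf{\Theta}\mathbf{y}\rangle\big|\le\varepsilon\|\mathbf{x}\|\,\|\mathbf{y}\|\Big)\ge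 1-\delta .$$ Then, with $\log$ the natural logarithm: 1. if $k\ge 7.87\,\varepsilon^{-2}\big(6.9\,d+\log(1/\delta)\big)$, then $\mathbf{\Theta}$ is an $(\varepsilon,\delta,d)$ oblivious $\ell_2\to\ell_2$ subspace embedding over $\mathbb{R}$; 2. if $k\ge 7.87\,\varepsilon^{-2}\big(13.8\,d+\log(1/\delta)\big)$, then $\mathbf{\Theta}$ (a real matrix acting on complex vectors) is an $(\varepsilon,\delta,d)$ oblivious $\ell_2\to\ell_2$ subspace embedding over $\mathbb{C}$. -/

import Mathlib

open MeasureTheory ProbabilityTheory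
open scoped NNReal

/-- The deterministic matrix `Θ : 𝕜^{k × n}` is an `ℓ₂ → ℓ₂` `ε`-subspace embedding for the subspace
`V` of `𝕜ⁿ`: `ε ∈ [0, 1)` and `|⟨x, y⟩ - ⟨Θ x, Θ y⟩| ≤ ε ‖x‖ ‖y‖` for all `x, y ∈ V`. -/
def IsSubspaceEmbedding {𝕜 : Type*} [RCLike 𝕜] {k n : ℕ} (ε : ℝ)
    (Θ : Matrix (Fin k) (Fin n) 𝕜) (V : Submodule 𝕜 (EuclideanSpace 𝕜 (Fin n))) : Prop :=
  0 ≤ ε ∧ ε < 1 ∧ ∀ x ∈ V, ∀ y ∈ V,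
    ‖inner 𝕜 x y - inner 𝕜 (WithLp.toLp 2 (Θ.mulVec x.ofLp) : EuclideanSpace 𝕜 (Fin k))
        (WithLp.toLp 2 (Θ.mulVec y.ofLp) : EuclideanSpace 𝕜 (Fin k))‖ ≤ ε * ‖x‖ * ‖y‖

/-- The random matrix `Θ`, defined on the probability space `(Ω, μ)`, is an `(ε, δ, d)` oblivious
`ℓ₂ → ℓ₂` subspace embedding: for each `d`-dimensional subspace `V` of `𝕜ⁿ`, with probability at
least `1 - δ` it is an `ε`-subspace embedding for `V`. -/
def IsObliviousSubspaceEmbedding {𝕜 : Type*} [RCLike 𝕜] {k n : ℕ} {Ω : Type*} [MeasurableSpace Ω]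
    (ε δ : ℝ) (d : ℕ) (Θ : Ω → Matrix (Fin k) (Fin n) 𝕜) (μ : Measure Ω) : Prop :=
  ∀ V : Submodule 𝕜 (EuclideanSpace 𝕜 (Fin n)), Module.finrank 𝕜 V = d →
    1 - δ ≤ μ.real {ω | IsSubspaceEmbedding ε (Θ ω) V}

/-- `Θ` is a rescaled Gaussian `k × n` matrix: its entries are independent normal random variables
with mean `0` and variance `k⁻¹`. -/
def IsRescaledGaussian {k n : ℕ} {Ω : Type*} [MeasurableSpace Ω]
    (Θ : Ω → Matrix (Fin k) (Fin n) ℝ) (μ : Measure Ω) : Prop :=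
  iIndepFun (fun (p : Fin k × Fin n) ω => Θ ω p.1 p.2) μ ∧
    ∀ i j, HasLaw (fun ω => Θ ω i j) (gaussianReal 0 ((k : ℝ≥0)⁻¹)) μ

/-- `Θ` is a rescaled Rademacher `k × n` matrix: its entries are independent random variables that
take each of the values `k^{-1/2}` and `-k^{-1/2}` with probability `1/2`. -/
def IsRescaledRademacher {k n : ℕ} {Ω : Type*} [MeasurableSpace Ω]
    (Θ : Ω → Matrix (Fin k) (Fin n) ℝ) (μ : Measure Ω) : Prop :=
  iIndepFun (fun (p : Fin k × Fin n) ω => Θ ω p.1 p.2) μ ∧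
    ∀ i j, AEMeasurable (fun ω => Θ ω i j) μ ∧
      μ.real {ω | Θ ω i j = (Real.sqrt k)⁻¹} = 1 / 2 ∧
      μ.real {ω | Θ ω i j = -(Real.sqrt k)⁻¹} = 1 / 2

/-! For a unit vector `x`, `k‖Θx‖²` is a sum of `k` independent squares of centred sub-Gaussian
variables with variance proxy and variance both equal to one. Chernoff bounds for such sums give `|1
- ‖Θx‖²| ≥ η` with probability at most `2 exp(-0.133 η² k)` (`measureReal_abs_sum_sq_sub_ge_le`,
`measureReal_embeddingDefect_ge_le`).

The unit sphere of an `m`-dimensional real subspace has a `1/100`-net of at most `201 ^ m` points,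
so a union bound with `η = 0.98 ε` costs a factor `201 ^ m * 2 ≤ 402 ^ m ≤ exp (6.9 m)` for `m ≥ 1`.
The defect `⟨x, y⟩ - ⟨Θx, Θy⟩` is a symmetric bilinear form, and a bound for its quadratic form on a
`γ`-net extends to all pairs with loss `1 / (1 - 2γ) = 1 / 0.98` (`abs_bilin_le_of_net`), which
restores `ε`.

A complex `d`-dimensional subspace reduces to the real subspace of its real parts, of dimension at
most `2d`, with no loss in `ε` (`norm_complex_defect_le`). -/

/-! ### Nets of the unit sphere by volume comparison. -/

section Net

variable {F : Type*} [NormedAddCommGroup F] [NormedSpace ℝ F] [FiniteDimensional ℝ F]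

/-- A `γ`-separated subset of the unit ball has at most `(2 / γ + 1) ^ dim` points. -/
theorem card_le_of_separated_unitBall {γ : ℝ} (hγ : 0 < γ) (s : Finset F) (hs : ∀ c ∈ s, ‖c‖ ≤ 1)
    (h : ∀ c ∈ s, ∀ d ∈ s, c ≠ d → γ ≤ ‖c - d‖) :
    (s.card : ℝ) ≤ (2 / γ + 1) ^ Module.finrank ℝ F := by
  borelize F
  let ν : Measure F := Measure.addHaar
  have hδ : 0 < γ / 2 := by positivity
  have hρ : 0 < 1 + γ / 2 := by positivity
  have hdisj : (s : Set F).PairwiseDisjoint fun c => Metric.ball c (γ / 2) := by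
    rintro c hc d hd hcd
    apply Metric.ball_disjoint_ball
    rw [dist_eq_norm]
    linarith [h c hc d hd hcd]
  have hsub : (⋃ c ∈ s, Metric.ball c (γ / 2)) ⊆ Metric.ball (0 : F) (1 + γ / 2) := by
    refine Set.iUnion₂_subset fun x hx => Metric.ball_subset_ball' ?_
    rw [dist_zero_right]
    linarith [hs x hx]
  have hvol : (s.card : ENNReal) * ENNReal.ofReal ((γ / 2) ^ Module.finrank ℝ F) *
      ν (Metric.ball 0 1) ≤
      ENNReal.ofReal ((1 + γ / 2) ^ Module.finrank ℝ F) * ν (Metric.ball 0 1) := by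
    calc
      _ = ν (⋃ c ∈ s, Metric.ball c (γ / 2)) := by
        rw [measure_biUnion_finset hdisj fun c _ => measurableSet_ball]
        simp only [ν.addHaar_ball_of_pos _ hδ, Finset.sum_const, nsmul_eq_mul, mul_assoc]
      _ ≤ ν (Metric.ball (0 : F) (1 + γ / 2)) := measure_mono hsub
      _ = _ := ν.addHaar_ball_of_pos _ hρ
  have hcard := (ENNReal.mul_le_mul_iff_left (Metric.measure_ball_pos ν _ zero_lt_one).ne'
    measure_ball_lt_top.ne).1 hvol
  have hreal := ENNReal.toReal_le_of_le_ofReal (pow_nonneg hρ.le _) hcard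
  rw [ENNReal.toReal_mul, ENNReal.toReal_natCast, ENNReal.toReal_ofReal (by positivity)] at hreal
  have heq : 2 / γ + 1 = (1 + γ / 2) / (γ / 2) := by field_simp
  rw [heq, div_pow, le_div_iff₀ (by positivity)]
  exact hreal

/-- The unit sphere has a `γ`-net with at most `(2 / γ + 1) ^ dim` points. -/
theorem exists_sphere_net {γ : ℝ} (hγ : 0 < γ) :
    ∃ N : Finset F, (∀ y ∈ N, ‖y‖ = 1) ∧ (N.card : ℝ) ≤ (2 / γ + 1) ^ Module.finrank ℝ F ∧
      ∀ x : F, ‖x‖ = 1 → ∃ y ∈ N, ‖x - y‖ ≤ γ := by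
  classical
  let A : Set ℕ := {m | ∃ s : Finset F, s.card = m ∧ (∀ c ∈ s, ‖c‖ = 1) ∧
    ∀ c ∈ s, ∀ d ∈ s, c ≠ d → γ ≤ ‖c - d‖}
  have hbdd : BddAbove A := by
    refine ⟨⌊(2 / γ + 1) ^ Module.finrank ℝ F⌋₊, ?_⟩
    rintro _ ⟨s, rfl, h1, h2⟩
    exact Nat.le_floor (card_le_of_separated_unitBall hγ s (fun c hc => (h1 c hc).le) h2)
  -- A separated subset of the sphere of largest cardinality is a net: a point farther than `γ` from
  -- all of it could be added.
  obtain ⟨s, hcard, h1, h2⟩ := Nat.sSup_mem (s := A) ⟨0, ∅, by simp⟩ hbdd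
  refine ⟨s, h1, card_le_of_separated_unitBall hγ s (fun c hc => (h1 c hc).le) h2,
    fun x hx => ?_⟩
  by_contra! hfar
  have hxs : x ∉ s := fun hmem => by
    have := hfar x hmem
    simp at this
    linarith
  have hmem : s.card + 1 ∈ A := by
    refine ⟨insert x s, Finset.card_insert_of_notMem hxs, ?_, ?_⟩
    · simpa [hx] using h1
    · intro c hc d hd hcd
      rcases Finset.mem_insert.1 hc with rfl | hc' <;>
        rcases Finset.mem_insert.1 hd with rfl | hd'
      · exact absurd rfl hcd
      · exact (hfar d hd').le
      · rw [norm_sub_rev]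
        exact (hfar c hc').le
      · exact h2 c hc' d hd' hcd
  have := le_csSup hbdd hmem
  omega

end Net

/-! ### Symmetric bilinear forms and their quadratic forms on a net. -/

section SymmetricForm

variable {F : Type*} [NormedAddCommGroup F] [InnerProductSpace ℝ F]

/-- A symmetric bilinear form is bounded by its quadratic form. -/
theorem abs_bilin_le_of_abs_quadratic_le (B : F →ₗ[ℝ] F →ₗ[ℝ] ℝ) (hB : ∀ x y, B x y = B y x)
    {M : ℝ} (hM : ∀ x, |B x x| ≤ M * ‖x‖ ^ 2) (x y : F) : |B x y| ≤ M * ‖x‖ * ‖y‖ := by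
  -- For unit vectors, polarization and the parallelogram law give exactly `M`; the general case
  -- follows by scaling.
  have key : ∀ u v : F, ‖u‖ = 1 → ‖v‖ = 1 → |B u v| ≤ M := by
    intro u v hu hv
    have hpol : B u v = (B (u + v) (u + v) - B (u - v) (u - v)) / 4 := by
      simp only [map_add, map_sub, LinearMap.add_apply, LinearMap.sub_apply, hB v u]
      ring
    have hpar := parallelogram_law_with_norm ℝ u v
    rw [hu, hv] at hpar
    have h1 := abs_le.1 (hM (u + v))
    have h2 := abs_le.1 (hM (u - v))
    have h3 : M * ‖u + v‖ ^ 2 + M * ‖u - v‖ ^ 2 = 4 * M := by linear_combination M * hpar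
    rw [hpol, abs_le]
    constructor <;> linarith [h1.1, h1.2, h2.1, h2.2]
  rcases eq_or_ne x 0 with rfl | hx
  · simp
  rcases eq_or_ne y 0 with rfl | hy
  · simp
  have hx' : 0 < ‖x‖ := norm_pos_iff.2 hx
  have hy' : 0 < ‖y‖ := norm_pos_iff.2 hy
  have h := key (‖x‖⁻¹ • x) (‖y‖⁻¹ • y) (by simp [norm_smul, hx'.ne'])
    (by simp [norm_smul, hy'.ne'])
  simp only [map_smul, LinearMap.smul_apply, smul_eq_mul, abs_mul, abs_inv, abs_norm] at h
  calc |B x y| = (‖y‖⁻¹ * (‖x‖⁻¹ * |B x y|)) * (‖x‖ * ‖y‖) := by field_simp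
    _ ≤ M * (‖x‖ * ‖y‖) := by gcongr
    _ = M * ‖x‖ * ‖y‖ := by ring

/-- A symmetric bilinear form is controlled by its quadratic form on a net of the sphere. -/
theorem abs_bilin_le_of_net [FiniteDimensional ℝ F] (B : F →ₗ[ℝ] F →ₗ[ℝ] ℝ)
    (hB : ∀ x y, B x y = B y x) (hcont : Continuous fun x => B x x) {N : Set F} {γ η : ℝ}
    (hγ : γ < 1 / 2) (hN1 : ∀ y ∈ N, ‖y‖ = 1) (hN : ∀ x : F, ‖x‖ = 1 → ∃ y ∈ N, ‖x - y‖ ≤ γ)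
    (hη : ∀ y ∈ N, |B y y| ≤ η) (x y : F) : |B x y| ≤ η / (1 - 2 * γ) * ‖x‖ * ‖y‖ := by
  rcases subsingleton_or_nontrivial F with hF | hF
  · simp [Subsingleton.elim x 0]
  obtain ⟨x₀, hx₀, hmax⟩ := (isCompact_sphere (0 : F) 1).exists_isMaxOn
    (NormedSpace.sphere_nonempty.2 zero_le_one) hcont.abs.continuousOn
  rw [mem_sphere_zero_iff_norm] at hx₀
  have hquad : ∀ z : F, |B z z| ≤ |B x₀ x₀| * ‖z‖ ^ 2 := by
    intro z
    rcases eq_or_ne z 0 with rfl | hz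
    · simp
    have hz' : 0 < ‖z‖ := norm_pos_iff.2 hz
    have h := hmax (a := ‖z‖⁻¹ • z) (by simp [norm_smul, hz'.ne'])
    simp only [Set.mem_ofPred_eq, map_smul, LinearMap.smul_apply, smul_eq_mul, abs_mul, abs_inv,
      abs_norm] at h
    calc |B z z| = (‖z‖⁻¹ * (‖z‖⁻¹ * |B z z|)) * ‖z‖ ^ 2 := by field_simp
      _ ≤ _ := by gcongr
  have hbil := abs_bilin_le_of_abs_quadratic_le B hB hquad
  set M := |B x₀ x₀|
  have hM0 : 0 ≤ M := abs_nonneg _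
  have hMη : M ≤ η / (1 - 2 * γ) := by
    obtain ⟨v, hv, hxv⟩ := hN x₀ hx₀
    -- By symmetry the difference of the two squares factors. Since `x₀` maximizes `|B x x|` on the
    -- sphere, the bilinear bound with the same `M` applies to the product, whence `M ≤ 2γM + η`.
    have hdiff : B x₀ x₀ = B (x₀ - v) (x₀ + v) + B v v := by
      simp only [map_add, map_sub, LinearMap.sub_apply, hB v x₀]
      ring
    have h1 : |B (x₀ - v) (x₀ + v)| ≤ M * γ * 2 := by
      refine (hbil _ _).trans ?_
      have : ‖x₀ + v‖ ≤ 2 := (norm_add_le _ _).trans (by rw [hx₀, hN1 v hv]; norm_num)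
      have hγ0 : 0 ≤ γ := (norm_nonneg _).trans hxv
      gcongr
    have h2 : M ≤ M * γ * 2 + η := by
      calc M = |B (x₀ - v) (x₀ + v) + B v v| := by rw [← hdiff]
        _ ≤ _ := (abs_add_le _ _).trans (add_le_add h1 (hη v hv))
    rw [le_div_iff₀ (by linarith)]
    linarith
  exact (hbil x y).trans (by gcongr)

end SymmetricForm

/-! ### The embedding defect, and the passage from real to complex subspaces. -/

section Deterministic

variable {k n : ℕ}

/-- The defect `⟨x, y⟩ - ⟨Θ x, Θ y⟩` as a real bilinear form. -/
noncomputable def embeddingDefect (Θ : Matrix (Fin k) (Fin n) ℝ) :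
    EuclideanSpace ℝ (Fin n) →ₗ[ℝ] EuclideanSpace ℝ (Fin n) →ₗ[ℝ] ℝ :=
  innerₗ (EuclideanSpace ℝ (Fin n)) -
    (innerₗ (EuclideanSpace ℝ (Fin k))).compl₁₂ Θ.toEuclideanLin Θ.toEuclideanLin

theorem embeddingDefect_apply (Θ : Matrix (Fin k) (Fin n) ℝ) (x y : EuclideanSpace ℝ (Fin n)) :
    embeddingDefect Θ x y = inner ℝ x y -
      inner ℝ (WithLp.toLp 2 (Θ.mulVec x.ofLp) : EuclideanSpace ℝ (Fin k))
        (WithLp.toLp 2 (Θ.mulVec y.ofLp)) := rfl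

theorem embeddingDefect_comm (Θ : Matrix (Fin k) (Fin n) ℝ) (x y : EuclideanSpace ℝ (Fin n)) :
    embeddingDefect Θ x y = embeddingDefect Θ y x := by
  rw [embeddingDefect_apply, embeddingDefect_apply, real_inner_comm]
  congr 1
  exact real_inner_comm _ _

theorem embeddingDefect_self (Θ : Matrix (Fin k) (Fin n) ℝ) (x : EuclideanSpace ℝ (Fin n)) :
    embeddingDefect Θ x x = ‖x‖ ^ 2 - ∑ i, (∑ j, Θ i j * x j) ^ 2 := by
  rw [embeddingDefect_apply, real_inner_self_eq_norm_sq, real_inner_self_eq_norm_sq,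
    EuclideanSpace.real_norm_sq_eq (WithLp.toLp 2 (Θ.mulVec x.ofLp))]
  rfl

theorem continuous_embeddingDefect_self (Θ : Matrix (Fin k) (Fin n) ℝ) :
    Continuous fun x => embeddingDefect Θ x x := by
  simp only [embeddingDefect_self]
  fun_prop

/-- A real matrix that nearly preserves the norms of a net of the sphere of `W` nearly preserves
inner products on `W`. -/
theorem abs_embeddingDefect_le_of_net (Θ : Matrix (Fin k) (Fin n) ℝ)
    (W : Submodule ℝ (EuclideanSpace ℝ (Fin n))) {N : Set W} {γ η : ℝ}
    (hγ : γ < 1 / 2) (hN1 : ∀ y ∈ N, ‖y‖ = 1) (hN : ∀ x : W, ‖x‖ = 1 → ∃ y ∈ N, ‖x - y‖ ≤ γ)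
    (hη : ∀ y ∈ N, |embeddingDefect Θ y y| ≤ η) {x y : EuclideanSpace ℝ (Fin n)}
    (hx : x ∈ W) (hy : y ∈ W) : |embeddingDefect Θ x y| ≤ η / (1 - 2 * γ) * ‖x‖ * ‖y‖ :=
  abs_bilin_le_of_net ((embeddingDefect Θ).compl₁₂ W.subtype W.subtype)
    (fun x y => embeddingDefect_comm Θ x y)
    ((continuous_embeddingDefect_self Θ).comp continuous_subtype_val) hγ hN1 hN hη ⟨x, hx⟩ ⟨y, hy⟩

/-- The coordinatewise real part, as a real linear map. -/
noncomputable def euclideanRe (n : ℕ) :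
    EuclideanSpace ℂ (Fin n) →ₗ[ℝ] EuclideanSpace ℝ (Fin n) where
  toFun x := WithLp.toLp 2 fun i => (x i).re
  map_add' x y := by ext i; simp
  map_smul' c x := by ext i; simp

/-- The coordinatewise imaginary part, as a real linear map. -/
noncomputable def euclideanIm (n : ℕ) :
    EuclideanSpace ℂ (Fin n) →ₗ[ℝ] EuclideanSpace ℝ (Fin n) where
  toFun x := WithLp.toLp 2 fun i => (x i).im
  map_add' x y := by ext i; simp
  map_smul' c x := by ext i; simp

/-- Because a complex subspace is stable under `-i`, its real parts already include its imaginary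
parts, so one real subspace serves for both. -/
theorem euclideanRe_neg_I_smul (x : EuclideanSpace ℂ (Fin n)) :
    euclideanRe n (-Complex.I • x) = euclideanIm n x := by
  ext i
  simp [euclideanRe, euclideanIm]

theorem re_inner_eq_add (x y : EuclideanSpace ℂ (Fin n)) :
    (inner ℂ x y).re = inner ℝ (euclideanRe n x) (euclideanRe n y) +
      inner ℝ (euclideanIm n x) (euclideanIm n y) := by
  simp only [PiLp.inner_apply, Complex.re_sum, ← Finset.sum_add_distrib]
  refine Finset.sum_congr rfl fun i _ => ?_
  simp [euclideanRe, euclideanIm]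

theorem norm_sq_eq_re_add_im (x : EuclideanSpace ℂ (Fin n)) :
    ‖x‖ ^ 2 = ‖euclideanRe n x‖ ^ 2 + ‖euclideanIm n x‖ ^ 2 := by
  have h := re_inner_eq_add x x
  rw [inner_self_eq_norm_sq_to_K, real_inner_self_eq_norm_sq, real_inner_self_eq_norm_sq] at h
  rw [← h]
  norm_cast

theorem euclideanRe_mulVec (Θ : Matrix (Fin k) (Fin n) ℝ) (x : EuclideanSpace ℂ (Fin n)) :
    euclideanRe k (WithLp.toLp 2 ((Θ.map fun t : ℝ => (t : ℂ)).mulVec x.ofLp)) =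
      WithLp.toLp 2 (Θ.mulVec (euclideanRe n x).ofLp) := by
  ext i
  simp [euclideanRe, Matrix.mulVec, dotProduct]

theorem euclideanIm_mulVec (Θ : Matrix (Fin k) (Fin n) ℝ) (x : EuclideanSpace ℂ (Fin n)) :
    euclideanIm k (WithLp.toLp 2 ((Θ.map fun t : ℝ => (t : ℂ)).mulVec x.ofLp)) =
      WithLp.toLp 2 (Θ.mulVec (euclideanIm n x).ofLp) := by
  ext i
  simp [euclideanIm, Matrix.mulVec, dotProduct]

/-- A bound for the defect on the real parts of a complex subspace `V` passes to `V`. -/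
theorem norm_complex_defect_le (Θ : Matrix (Fin k) (Fin n) ℝ)
    (V : Submodule ℂ (EuclideanSpace ℂ (Fin n))) {ε : ℝ} (hε : 0 ≤ ε)
    (h : ∀ a ∈ (V.restrictScalars ℝ).map (euclideanRe n),
      ∀ b ∈ (V.restrictScalars ℝ).map (euclideanRe n), |embeddingDefect Θ a b| ≤ ε * ‖a‖ * ‖b‖)
    {x y : EuclideanSpace ℂ (Fin n)} (hx : x ∈ V) (hy : y ∈ V) :
    ‖inner ℂ x y - inner ℂ
        (WithLp.toLp 2 ((Θ.map fun t : ℝ => (t : ℂ)).mulVec x.ofLp) : EuclideanSpace ℂ (Fin k))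
        (WithLp.toLp 2 ((Θ.map fun t : ℝ => (t : ℂ)).mulVec y.ofLp))‖ ≤ ε * ‖x‖ * ‖y‖ := by
  set H : EuclideanSpace ℂ (Fin n) → EuclideanSpace ℂ (Fin n) → ℂ := fun x y =>
    inner ℂ x y - inner ℂ
        (WithLp.toLp 2 ((Θ.map fun t : ℝ => (t : ℂ)).mulVec x.ofLp) : EuclideanSpace ℂ (Fin k))
        (WithLp.toLp 2 ((Θ.map fun t : ℝ => (t : ℂ)).mulVec y.ofLp)) with hH
  have hre : ∀ z ∈ V, euclideanRe n z ∈ (V.restrictScalars ℝ).map (euclideanRe n) :=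
    fun z hz => Submodule.mem_map_of_mem hz
  have him : ∀ z ∈ V, euclideanIm n z ∈ (V.restrictScalars ℝ).map (euclideanRe n) := by
    intro z hz
    rw [← euclideanRe_neg_I_smul]
    exact hre _ (V.smul_mem _ hz)
  have hbound : ∀ y ∈ V, (H x y).re ≤ ε * ‖x‖ * ‖y‖ := by
    intro y hy
    have hHre : (H x y).re = embeddingDefect Θ (euclideanRe n x) (euclideanRe n y) +
        embeddingDefect Θ (euclideanIm n x) (euclideanIm n y) := by
      simp only [hH, Complex.sub_re, re_inner_eq_add, euclideanRe_mulVec, euclideanIm_mulVec,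
        embeddingDefect_apply]
      ring
    have h1 := (le_abs_self _).trans (h _ (hre x hx) _ (hre y hy))
    have h2 := (le_abs_self _).trans (h _ (him x hx) _ (him y hy))
    -- Cauchy–Schwarz in the plane; this is why the real and imaginary contributions combine without
    -- enlarging `ε`.
    have hcs : ‖euclideanRe n x‖ * ‖euclideanRe n y‖ + ‖euclideanIm n x‖ * ‖euclideanIm n y‖ ≤
        ‖x‖ * ‖y‖ := by
      refine abs_le_of_sq_le_sq' ?_ (by positivity) |>.2
      rw [mul_pow, norm_sq_eq_re_add_im x, norm_sq_eq_re_add_im y]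
      nlinarith [sq_nonneg (‖euclideanRe n x‖ * ‖euclideanIm n y‖ -
        ‖euclideanIm n x‖ * ‖euclideanRe n y‖)]
    rw [hHre]
    nlinarith [mul_le_mul_of_nonneg_left hcs hε]
  have hsmul : ∀ u : ℂ, H x (u • y) = u * H x y := by
    intro u
    simp only [hH, WithLp.ofLp_smul, Matrix.mulVec_smul, WithLp.toLp_smul, inner_smul_right]
    ring
  rcases eq_or_ne (H x y) 0 with h0 | h0
  · change ‖H x y‖ ≤ _
    rw [h0, norm_zero]
    positivity
  have hn : (‖H x y‖ : ℂ) ≠ 0 := by simpa using h0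
  -- Rotating `y` by the conjugate phase of `H x y` makes the value real and equal to `‖H x y‖`.
  have hmain := hbound (((starRingEnd ℂ) (H x y) / ‖H x y‖) • y) (V.smul_mem _ hy)
  rw [hsmul, norm_smul, norm_div, RCLike.norm_conj, Complex.norm_real, norm_norm,
    div_self (by simpa using h0), one_mul, div_mul_eq_mul_div, Complex.conj_mul', pow_two,
    mul_div_assoc, div_self hn, mul_one, Complex.ofReal_re] at hmain
  exact hmain

theorem finrank_map_euclideanRe_le (V : Submodule ℂ (EuclideanSpace ℂ (Fin n))) :
    Module.finrank ℝ ((V.restrictScalars ℝ).map (euclideanRe n)) ≤ 2 * Module.finrank ℂ V := by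
  refine (Submodule.finrank_map_le _ _).trans (le_of_eq ?_)
  exact finrank_real_of_complex V

end Deterministic

/-! ### Elementary inequalities and numerical constants. -/

section RealInequalities

/-- The product `(1 - u + u²/2)(1 + u + u²/2)` equals `1 + u⁴/4 ≥ 1`. -/
theorem exp_neg_le_quadratic {u : ℝ} (hu : 0 ≤ u) : Real.exp (-u) ≤ 1 - u + u ^ 2 / 2 := by
  have h := Real.quadratic_le_exp_of_nonneg hu
  rw [Real.exp_neg, inv_le_iff_one_le_mul₀ (Real.exp_pos u)]
  have hpos : 0 ≤ 1 - u + u ^ 2 / 2 := by nlinarith [sq_nonneg (u - 1)]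
  nlinarith [mul_le_mul_of_nonneg_left h hpos, sq_nonneg (u ^ 2)]

theorem quartic_le_cosh (x : ℝ) : 1 + x ^ 2 / 2 + x ^ 4 / 24 ≤ Real.cosh x := by
  have h := sum_le_hasSum (Finset.range 3)
    (fun i _ => div_nonneg (even_two_mul i |>.pow_nonneg x) (Nat.cast_nonneg _))
    (Real.hasSum_cosh x)
  simpa [Finset.sum_range_succ, Nat.factorial] using h

/-- The quartic term `t²x⁴/2` is traded for `cosh`, whose expectation is read off from the moment
generating function at `±1`. -/
theorem exp_neg_mul_sq_le {t : ℝ} (ht : 0 ≤ t) (x : ℝ) :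
    Real.exp (-t * x ^ 2) ≤ 1 - t * x ^ 2 + 12 * t ^ 2 * (Real.cosh x - 1 - x ^ 2 / 2) := by
  have h1 := exp_neg_le_quadratic (mul_nonneg ht (sq_nonneg x))
  have h2 := mul_le_mul_of_nonneg_left (quartic_le_cosh x) (sq_nonneg t)
  rw [neg_mul]
  nlinarith

theorem exp_half_le : Real.exp (1 / 2) ≤ 1.65 := by
  refine abs_le_of_sq_le_sq' ?_ (by norm_num) |>.2
  rw [← Real.exp_nat_mul]
  norm_num
  linarith [Real.exp_one_lt_d9]

theorem one_add_le_exp_sub {η : ℝ} (h0 : 0 ≤ η) (h1 : η ≤ 0.561) :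
    1 + η ≤ Real.exp (η - 0.266 * η ^ 2) := by
  have hy : 0 ≤ η - 0.266 * η ^ 2 := by nlinarith
  refine le_trans ?_ (Real.quadratic_le_exp_of_nonneg hy)
  have : 0.266 * η ^ 2 ≤ (η - 0.266 * η ^ 2) ^ 2 / 2 := by
    have h2 : (0.85 : ℝ) ≤ 1 - 0.266 * η := by linarith
    have h3 : (0.85 : ℝ) ^ 2 ≤ (1 - 0.266 * η) ^ 2 := by gcongr
    nlinarith [mul_le_mul_of_nonneg_left h3 (sq_nonneg η)]
  linarith

theorem le_exp_six_point_nine : (402 : ℝ) ≤ Real.exp 6.9 := by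
  have h1 : Real.exp 6.9 = Real.exp 1 ^ 6 * Real.exp 0.9 := by
    rw [← Real.exp_nat_mul, ← Real.exp_add]
    norm_num
  have h2 : (2.7 : ℝ) ^ 6 ≤ Real.exp 1 ^ 6 := by
    gcongr
    linarith [Real.exp_one_gt_d9]
  have h3 := Real.add_one_le_exp (0.9 : ℝ)
  rw [h1]
  calc (402 : ℝ) ≤ 2.7 ^ 6 * (0.9 + 1) := by norm_num
    _ ≤ _ := by gcongr

end RealInequalities

/-! ### Chernoff bounds for sums of squares of sub-Gaussian variables. -/

section SubgaussianSquare

variable {Ω : Type*} [MeasurableSpace Ω] {μ : Measure Ω}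

theorem integrable_exp_mul_sq_gaussianReal {t : ℝ} (ht : t < 1 / 2) :
    Integrable (fun g : ℝ => Real.exp (t * g ^ 2)) (gaussianReal 0 1) ∧
      ∫ g, Real.exp (t * g ^ 2) ∂gaussianReal 0 1 = (√(1 - 2 * t))⁻¹ := by
  have heq : ∀ g : ℝ, gaussianPDFReal 0 1 g • Real.exp (t * g ^ 2) =
      (√(2 * Real.pi))⁻¹ * Real.exp (-(1 / 2 - t) * g ^ 2) := by
    intro g
    rw [gaussianPDFReal_def, smul_eq_mul, mul_assoc, ← Real.exp_add]
    congr 2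
    · simp
    · simp
      ring
  constructor
  · rw [gaussianReal_of_var_ne_zero _ one_ne_zero,
      integrable_withDensity_iff_integrable_smul' (measurable_gaussianPDF 0 1)
        (Filter.Eventually.of_forall fun _ => gaussianPDF_lt_top)]
    simp only [toReal_gaussianPDF, heq]
    exact (integrable_exp_neg_mul_sq (by linarith)).const_mul _
  · rw [integral_gaussianReal_eq_integral_smul one_ne_zero]
    simp only [heq]
    rw [integral_const_mul, integral_gaussian, ← Real.sqrt_inv, ← Real.sqrt_inv,
      ← Real.sqrt_mul (by positivity)]
    congr 1
    have : 1 / 2 - t ≠ 0 := by linarith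
    have : 1 - 2 * t ≠ 0 := by linarith
    field_simp

/-- The exponential square moment of a sub-Gaussian variable is dominated by that of the
standard normal law. -/
theorem ProbabilityTheory.HasSubgaussianMGF.exp_mul_sq [IsProbabilityMeasure μ] {X : Ω → ℝ}
    (hX : HasSubgaussianMGF X 1 μ) {t : ℝ} (ht0 : 0 ≤ t) (ht : t < 1 / 2) :
    Integrable (fun ω => Real.exp (t * X ω ^ 2)) μ ∧
      ∫ ω, Real.exp (t * X ω ^ 2) ∂μ ≤ (√(1 - 2 * t))⁻¹ := by
  have hm : AEMeasurable X μ := hX.aemeasurable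
  -- Linearization of the square: `exp (t x²)` is the average of `exp (s x g)` over a standard
  -- normal `g`, as `s² = 2t`. Tonelli then allows the sub-Gaussian bound for `X` to be used at `s
  -- g` for each fixed `g`.
  set s := √(2 * t) with hs
  have hs2 : s ^ 2 = 2 * t := Real.sq_sqrt (by linarith)
  obtain ⟨hgi, hg⟩ := integrable_exp_mul_sq_gaussianReal ht
  have hgauss : ∀ x : ℝ, ENNReal.ofReal (Real.exp (t * x ^ 2)) =
      ∫⁻ g, ENNReal.ofReal (Real.exp (s * x * g)) ∂gaussianReal 0 1 := by
    intro x
    rw [← ofReal_integral_eq_lintegral_ofReal (integrable_exp_mul_gaussianReal (s * x))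
      (Filter.Eventually.of_forall fun _ => (Real.exp_pos _).le)]
    have := congrFun (mgf_id_gaussianReal (μ := 0) (v := 1)) (s * x)
    simp only [mgf, id_eq] at this
    rw [this, mul_pow, hs2]
    congr 2
    push_cast
    ring
  have hsub : ∀ g : ℝ, ∫⁻ ω, ENNReal.ofReal (Real.exp (s * X ω * g)) ∂μ ≤
      ENNReal.ofReal (Real.exp (t * g ^ 2)) := by
    intro g
    have hcomm : ∀ ω, s * X ω * g = (s * g) * X ω := fun ω => by ring
    simp only [hcomm]
    rw [← ofReal_integral_eq_lintegral_ofReal (hX.integrable_exp_mul (s * g))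
      (Filter.Eventually.of_forall fun _ => (Real.exp_pos _).le)]
    refine ENNReal.ofReal_le_ofReal ((hX.mgf_le (s * g)).trans (le_of_eq ?_))
    rw [mul_pow, hs2]
    congr 1
    push_cast
    ring
  have hle : ∫⁻ ω, ENNReal.ofReal (Real.exp (t * X ω ^ 2)) ∂μ ≤
      ENNReal.ofReal ((√(1 - 2 * t))⁻¹) := by
    simp only [hgauss]
    rw [lintegral_lintegral_swap]
    · refine (lintegral_mono hsub).trans (le_of_eq ?_)
      rw [← hg, ofReal_integral_eq_lintegral_ofReal hgi
        (Filter.Eventually.of_forall fun _ => (Real.exp_pos _).le)]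
    · exact ((hm.comp_fst.const_mul s).mul measurable_snd.aemeasurable).exp.ennreal_ofReal
  have hmeas : AEMeasurable (fun ω => Real.exp (t * X ω ^ 2)) μ :=
    ((hm.pow_const 2).const_mul t).exp
  have hint : Integrable (fun ω => Real.exp (t * X ω ^ 2)) μ := by
    refine ⟨hmeas.aestronglyMeasurable, ?_⟩
    rw [hasFiniteIntegral_iff_ofReal (Filter.Eventually.of_forall fun _ => (Real.exp_pos _).le)]
    exact hle.trans_lt ENNReal.ofReal_lt_top
  refine ⟨hint, ?_⟩
  rw [← ofReal_integral_eq_lintegral_ofReal hint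
    (Filter.Eventually.of_forall fun _ => (Real.exp_pos _).le)] at hle
  exact (ENNReal.ofReal_le_ofReal_iff (by positivity)).1 hle

/-- Unit variance gives the linear term exactly. The remainder is `12 t² (E cosh X - 3/2)`, and `E
cosh X ≤ exp (1/2) ≤ 1.65` yields `12 · 0.15 = 1.8`. -/
theorem ProbabilityTheory.HasSubgaussianMGF.exp_neg_mul_sq [IsProbabilityMeasure μ] {X : Ω → ℝ}
    (hX : HasSubgaussianMGF X 1 μ) (hvar : ∫ ω, X ω ^ 2 ∂μ = 1) {t : ℝ} (ht0 : 0 ≤ t) :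
    Integrable (fun ω => Real.exp (-t * X ω ^ 2)) μ ∧
      ∫ ω, Real.exp (-t * X ω ^ 2) ∂μ ≤ 1 - t + 1.8 * t ^ 2 := by
  have hm : AEMeasurable X μ := hX.aemeasurable
  have hint : Integrable (fun ω => Real.exp (-t * X ω ^ 2)) μ := by
    refine Integrable.of_bound ((hm.pow_const 2).const_mul (-t)).exp.aestronglyMeasurable 1
      (Filter.Eventually.of_forall fun ω => ?_)
    rw [Real.norm_eq_abs, Real.abs_exp, Real.exp_le_one_iff]
    nlinarith [sq_nonneg (X ω)]
  refine ⟨hint, ?_⟩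
  have h1 := hX.integrable_exp_mul 1
  have h2 := hX.integrable_exp_mul (-1)
  have hsq : Integrable (fun ω => X ω ^ 2) μ := (hX.memLp 2).integrable_sq
  have hcoshi : Integrable (fun ω => Real.cosh (X ω)) μ := by
    simp only [Real.cosh_eq]
    simpa using (h1.add h2).div_const 2
  have hcosh : ∫ ω, Real.cosh (X ω) ∂μ ≤ 1.65 := by
    have he : ∫ ω, Real.cosh (X ω) ∂μ = (mgf X μ 1 + mgf X μ (-1)) / 2 := by
      rw [mgf, mgf, ← integral_add h1 h2, ← integral_div]
      simp [Real.cosh_eq]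
    have m1 := hX.mgf_le 1
    have m2 := hX.mgf_le (-1)
    norm_num at m1 m2
    have := exp_half_le
    norm_num at this
    rw [he]
    norm_num
    linarith
  calc ∫ ω, Real.exp (-t * X ω ^ 2) ∂μ
      ≤ ∫ ω, (1 - t * X ω ^ 2 + 12 * t ^ 2 * (Real.cosh (X ω) - 1 - X ω ^ 2 / 2)) ∂μ := by
        refine integral_mono hint ?_ fun ω => exp_neg_mul_sq_le ht0 (X ω)
        fun_prop
    _ = 1 - t + 12 * t ^ 2 * (∫ ω, Real.cosh (X ω) ∂μ - 1 - 1 / 2) := by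
        rw [integral_add (by fun_prop) (by fun_prop), integral_sub (by fun_prop) (by fun_prop),
          integral_const_mul, integral_const_mul, integral_sub (by fun_prop) (by fun_prop),
          integral_sub (by fun_prop) (by fun_prop), integral_div, hvar]
        simp
    _ ≤ _ := by nlinarith [mul_le_mul_of_nonneg_left hcosh (sq_nonneg t)]

/-- The moment generating function of a sum whose terms are successively independent. -/
theorem mgf_sum_le_pow [IsProbabilityMeasure μ] {ι : Type*} {Q : ι → Ω → ℝ}
    (hind : ∀ i s, i ∉ s → IndepFun (Q i) (∑ j ∈ s, Q j) μ) {t C : ℝ}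
    (hint : ∀ i, Integrable (fun ω => Real.exp (t * Q i ω)) μ) (hC : ∀ i, mgf (Q i) μ t ≤ C)
    (s : Finset ι) :
    Integrable (fun ω => Real.exp (t * (∑ i ∈ s, Q i) ω)) μ ∧
      mgf (∑ i ∈ s, Q i) μ t ≤ C ^ s.card := by
  classical
  induction s using Finset.induction_on with
  | empty => simp
  | insert i s his ih =>
    rw [Finset.sum_insert his, Finset.card_insert_of_notMem his]
    refine ⟨(hind i s his).integrable_exp_mul_add (hint i) ih.1, ?_⟩
    rw [(hind i s his).mgf_add (hint i).aestronglyMeasurable ih.1.aestronglyMeasurable, pow_succ']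
    exact mul_le_mul (hC i) ih.2 mgf_nonneg (mgf_nonneg.trans (hC i))

/-- Chernoff bounds for the sum of squares of sub-Gaussian variables of unit variance. -/
theorem measureReal_abs_sum_sq_sub_ge_le [IsProbabilityMeasure μ] {k : ℕ} {X : Fin k → Ω → ℝ}
    (hX : ∀ i, HasSubgaussianMGF (X i) 1 μ) (hvar : ∀ i, ∫ ω, X i ω ^ 2 ∂μ = 1)
    (hind : ∀ i s, i ∉ s → IndepFun (fun ω => X i ω ^ 2) (∑ j ∈ s, fun ω => X j ω ^ 2) μ)
    {η : ℝ} (h0 : 0 < η) (h1 : η ≤ 0.561) :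
    μ.real {ω | η * k ≤ |k - ∑ i, X i ω ^ 2|} ≤ 2 * Real.exp (-(0.133 * η ^ 2 * k)) := by
  have hup : μ.real {ω | (k : ℝ) * (1 + η) ≤ (∑ i, fun ω => X i ω ^ 2) ω} ≤
      Real.exp (-(0.133 * η ^ 2 * k)) := by
    -- The optimal Chernoff parameter for a chi-square variable, for which `1 - 2t = 1 / (1 + η)`.
    have ht0 : 0 ≤ η / (2 * (1 + η)) := by positivity
    have ht1 : η / (2 * (1 + η)) < 1 / 2 := by
      rw [div_lt_div_iff₀ (by positivity) (by positivity)]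
      linarith
    set t := η / (2 * (1 + η)) with ht
    have hsqrt : (√(1 - 2 * t))⁻¹ = √(1 + η) := by
      rw [← Real.sqrt_inv]
      congr 1
      rw [ht]
      field_simp
      ring
    have hS : √(1 + η) ≤ Real.exp (η / 2 - 0.133 * η ^ 2) := by
      rw [Real.sqrt_le_left (Real.exp_pos _).le, ← Real.exp_nat_mul]
      refine (one_add_le_exp_sub h0.le h1).trans (le_of_eq ?_)
      congr 1
      push_cast
      ring
    obtain ⟨hi, hle⟩ := mgf_sum_le_pow hind (t := t) (C := √(1 + η))
      (fun i => ((hX i).exp_mul_sq ht0 ht1).1)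
      (fun i => hsqrt ▸ ((hX i).exp_mul_sq ht0 ht1).2) Finset.univ
    refine (measure_ge_le_exp_mul_mgf _ ht0 hi).trans ?_
    calc _ ≤ Real.exp (-t * (k * (1 + η))) * Real.exp (η / 2 - 0.133 * η ^ 2) ^ k := by
          rw [Finset.card_univ, Fintype.card_fin] at hle
          gcongr
          exact hle.trans (by gcongr)
      _ = _ := by
          rw [← Real.exp_nat_mul, ← Real.exp_add, ht]
          congr 1
          field_simp
          ring
  have hlow : μ.real {ω | (∑ i, fun ω => X i ω ^ 2) ω ≤ (k : ℝ) * (1 - η)} ≤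
      Real.exp (-(0.133 * η ^ 2 * k)) := by
    -- This `t` minimizes the exponent `-ηt + 1.8 t²`, with minimum `-η² / 7.2`, and `1 / 7.2 >
    -- 0.133`.
    have ht0 : 0 ≤ η / 3.6 := by positivity
    set t := η / 3.6 with ht
    obtain ⟨hi, hle⟩ := mgf_sum_le_pow hind (t := -t) (C := 1 - t + 1.8 * t ^ 2)
      (fun i => ((hX i).exp_neg_mul_sq (hvar i) ht0).1)
      (fun i => ((hX i).exp_neg_mul_sq (hvar i) ht0).2) Finset.univ
    refine (measure_le_le_exp_mul_mgf _ (neg_nonpos.2 ht0) hi).trans ?_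
    have hC0 : 0 ≤ 1 - t + 1.8 * t ^ 2 := by nlinarith [sq_nonneg (t - 1)]
    have hC : 1 - t + 1.8 * t ^ 2 ≤ Real.exp (-t + 1.8 * t ^ 2) := by
      linarith [Real.add_one_le_exp (-t + 1.8 * t ^ 2)]
    calc _ ≤ Real.exp (- -t * (k * (1 - η))) * Real.exp (-t + 1.8 * t ^ 2) ^ k := by
          rw [Finset.card_univ, Fintype.card_fin] at hle
          gcongr
          exact hle.trans (by gcongr)
      _ = Real.exp (-(η ^ 2 / 7.2 * k)) := by
          rw [← Real.exp_nat_mul, ← Real.exp_add, ht]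
          congr 1
          ring
      _ ≤ _ := by
          gcongr
          rw [div_eq_mul_inv, mul_comm (0.133 : ℝ)]
          gcongr
          norm_num
  have hsub : {ω | η * k ≤ |k - ∑ i, X i ω ^ 2|} ⊆
      {ω | (k : ℝ) * (1 + η) ≤ (∑ i, fun ω => X i ω ^ 2) ω} ∪
        {ω | (∑ i, fun ω => X i ω ^ 2) ω ≤ (k : ℝ) * (1 - η)} := by
    intro ω hω
    simp only [Set.mem_union, Set.mem_ofPred_eq, Finset.sum_apply] at hω ⊢
    rcases le_abs.1 hω with h | h
    · right; linarith
    · left; linarith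
  refine (measureReal_mono hsub).trans ((measureReal_union_le _ _).trans ?_)
  linarith

end SubgaussianSquare

/-! ### Gaussian and Rademacher entries; the tail bound at one vector. -/

section Entries

variable {Ω : Type*} [MeasurableSpace Ω] {μ : Measure Ω} {k n : ℕ}

theorem ProbabilityTheory.HasSubgaussianMGF.of_coe_eq {X : Ω → ℝ} {c c' : ℝ≥0}
    (hX : HasSubgaussianMGF X c μ) (h : (c : ℝ) = c') : HasSubgaussianMGF X c' μ :=
  NNReal.coe_injective h ▸ hX

/-- The squares of the row sums of a matrix with independent entries are independent. -/
theorem indepFun_sq_row_sum {Θ : Ω → Matrix (Fin k) (Fin n) ℝ}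
    (hind : iIndepFun (fun (p : Fin k × Fin n) ω => Θ ω p.1 p.2) μ)
    (hm : ∀ i j, AEMeasurable (fun ω => Θ ω i j) μ) (c : Fin n → ℝ) (i : Fin k)
    (s : Finset (Fin k)) (his : i ∉ s) :
    IndepFun (fun ω => (∑ j, c j * Θ ω i j) ^ 2)
      (∑ i' ∈ s, fun ω => (∑ j, c j * Θ ω i' j) ^ 2) μ := by
  classical
  have hdisj : Disjoint (({i} : Finset (Fin k)) ×ˢ (Finset.univ : Finset (Fin n)))
      (s ×ˢ Finset.univ) := by
    rw [Finset.disjoint_product]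
    exact Or.inl (Finset.disjoint_singleton_left.2 his)
  have h := hind.indepFun_finset₀ _ _ hdisj fun p => hm p.1 p.2
  have hφ : Measurable fun z : (({i} : Finset (Fin k)) ×ˢ (Finset.univ : Finset (Fin n)) :
      Finset (Fin k × Fin n)) → ℝ => (∑ j, c j * z ⟨(i, j), by simp⟩) ^ 2 := by
    fun_prop
  have hψ : Measurable fun z : (s ×ˢ (Finset.univ : Finset (Fin n)) :
      Finset (Fin k × Fin n)) → ℝ =>
        ∑ i' : s, (∑ j, c j * z ⟨(i'.1, j), by simp⟩) ^ 2 := by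
    fun_prop
  convert h.comp hφ hψ using 1
  · rfl
  funext ω
  rw [Finset.sum_apply]
  exact (Finset.sum_coe_sort s fun i' => (∑ j, c j * Θ ω i' j) ^ 2).symm

/-- Tail bound for the norm defect at a unit vector. -/
theorem measureReal_embeddingDefect_ge_le [IsProbabilityMeasure μ]
    {Θ : Ω → Matrix (Fin k) (Fin n) ℝ} (hk : 0 < k)
    (hind : iIndepFun (fun (p : Fin k × Fin n) ω => Θ ω p.1 p.2) μ)
    (hsub : ∀ i j, HasSubgaussianMGF (fun ω => Θ ω i j) ((k : ℝ≥0)⁻¹) μ)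
    (hmean : ∀ i j, ∫ ω, Θ ω i j ∂μ = 0)
    (hvar : ∀ i j, Var[fun ω => Θ ω i j; μ] = (k : ℝ)⁻¹)
    {x : EuclideanSpace ℝ (Fin n)} (hx : ‖x‖ = 1) {η : ℝ} (h0 : 0 < η) (h1 : η ≤ 0.561) :
    μ.real {ω | η ≤ |embeddingDefect (Θ ω) x x|} ≤ 2 * Real.exp (-(0.133 * η ^ 2 * k)) := by
  have hk' : (0 : ℝ) < k := Nat.cast_pos.2 hk
  -- The factor `√k` cancels the entry variance `k⁻¹`, so each row sum has variance and variance
  -- proxy one.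
  set c : Fin n → ℝ := fun j => √k * x j with hc
  have hc2 : ∑ j, c j ^ 2 = k := by
    simp only [hc, mul_pow, Real.sq_sqrt hk'.le]
    rw [← Finset.mul_sum, ← EuclideanSpace.real_norm_sq_eq, hx]
    ring
  have hind' : ∀ i, iIndepFun (fun j ω => c j * Θ ω i j) μ := fun i =>
    (hind.precomp (g := fun j => (i, j)) (Prod.mk_right_injective i)).comp
      (fun j z => c j * z) (fun j => measurable_const_mul (c j))
  have hsub' : ∀ i j, HasSubgaussianMGF (fun ω => c j * Θ ω i j)
      (‖c j‖₊ ^ 2 * (k : ℝ≥0)⁻¹) μ := fun i j =>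
    ((hsub i j).const_mul (c j)).of_coe_eq <| by
      push_cast
      rw [Real.norm_eq_abs, sq_abs]
      rfl
  have hX : ∀ i, HasSubgaussianMGF (fun ω => ∑ j, c j * Θ ω i j) 1 μ := by
    intro i
    refine (HasSubgaussianMGF.sum_of_iIndepFun (hind' i) (s := Finset.univ)
      fun j _ => hsub' i j).of_coe_eq ?_
    push_cast
    simp only [Real.norm_eq_abs, sq_abs]
    rw [← Finset.sum_mul, hc2, mul_inv_cancel₀ hk'.ne']
  have hEX : ∀ i, ∫ ω, ∑ j, c j * Θ ω i j ∂μ = 0 := by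
    intro i
    rw [integral_finsetSum _ fun j _ => (hsub' i j).integrable]
    simp [integral_const_mul, hmean]
  have hVX : ∀ i, ∫ ω, (∑ j, c j * Θ ω i j) ^ 2 ∂μ = 1 := by
    intro i
    rw [← variance_of_integral_eq_zero (hX i).aemeasurable (hEX i)]
    have h := IndepFun.variance_sum (s := Finset.univ)
      (fun j _ => (hsub' i j).memLp 2) fun j _ j' _ hjj => (hind' i).indepFun hjj
    have heq : (∑ j, fun ω => c j * Θ ω i j) = fun ω => ∑ j, c j * Θ ω i j := by
      ext ω
      simp
    rw [heq] at h
    rw [h]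
    simp only [variance_const_mul, hvar]
    rw [← Finset.sum_mul, hc2, mul_inv_cancel₀ hk'.ne']
  have hmain := measureReal_abs_sum_sq_sub_ge_le hX hVX
    (indepFun_sq_row_sum hind (fun i j => (hsub i j).aemeasurable) c) h0 h1
  have hrow : ∀ ω, k - ∑ i, (∑ j, c j * Θ ω i j) ^ 2 = embeddingDefect (Θ ω) x x * k := by
    intro ω
    rw [embeddingDefect_self, hx, sub_mul, Finset.sum_mul, one_pow, one_mul]
    congr 1
    refine Finset.sum_congr rfl fun i _ => ?_
    have hfac : ∑ j, c j * Θ ω i j = √k * ∑ j, Θ ω i j * x j := by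
      rw [Finset.mul_sum]
      refine Finset.sum_congr rfl fun j _ => ?_
      rw [hc]
      ring
    rw [hfac, mul_pow, Real.sq_sqrt hk'.le, mul_comm]
  simpa only [hrow, abs_mul, abs_of_pos hk', mul_le_mul_iff_of_pos_right hk'] using hmain

/-- A symmetric two-valued variable is sub-Gaussian, centred, with the expected variance. -/
theorem rademacher_moments [IsProbabilityMeasure μ] {X : Ω → ℝ} {a : ℝ} (ha : 0 < a)
    (hX : AEMeasurable X μ) (hpos : μ.real {ω | X ω = a} = 1 / 2)
    (hneg : μ.real {ω | X ω = -a} = 1 / 2) :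
    HasSubgaussianMGF X (‖a‖₊ ^ 2) μ ∧ ∫ ω, X ω ∂μ = 0 ∧ Var[X; μ] = a ^ 2 := by
  have hA : NullMeasurableSet {ω | X ω = a} μ :=
    hX.nullMeasurableSet_preimage (measurableSet_singleton a)
  have hB : NullMeasurableSet {ω | X ω = -a} μ :=
    hX.nullMeasurableSet_preimage (measurableSet_singleton (-a))
  have hdisj : Disjoint {ω | X ω = a} {ω | X ω = -a} := by
    rw [Set.disjoint_left]
    intro ω h1 h2
    simp only [Set.mem_ofPred_eq] at h1 h2
    linarith
  have hae : ∀ᵐ ω ∂μ, X ω = a ∨ X ω = -a := by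
    have hunion : μ.real ({ω | X ω = a} ∪ {ω | X ω = -a}) = 1 := by
      rw [measureReal_union₀ hB hdisj.aedisjoint, hpos, hneg]
      norm_num
    have h1 : μ ({ω | X ω = a} ∪ {ω | X ω = -a}) = 1 := by
      rwa [measureReal_def, ENNReal.toReal_eq_one_iff] at hunion
    exact (prob_compl_eq_zero_iff₀ (hA.union hB)).2 h1
  have hmean : ∫ ω, X ω ∂μ = 0 := by
    have heq : X =ᵐ[μ] fun ω => {ω | X ω = a}.indicator (fun _ => a) ω +
        {ω | X ω = -a}.indicator (fun _ => -a) ω := by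
      filter_upwards [hae] with ω hω
      have hne : a ≠ -a := by linarith
      rcases hω with h | h <;> simp [h, hne, hne.symm]
    rw [integral_congr_ae heq, integral_add ((integrable_const a).indicator₀ hA)
      ((integrable_const (-a)).indicator₀ hB), integral_indicator₀ hA, integral_indicator₀ hB]
    simp only [setIntegral_const, hpos, hneg, smul_eq_mul]
    ring
  refine ⟨?_, hmean, ?_⟩
  -- Hoeffding's lemma on an interval of half-length `a` gives the proxy `a²`, which equals the
  -- variance.
  · have h := hasSubgaussianMGF_of_mem_Icc_of_integral_eq_zero (a := -a) (b := a) hX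
      (by filter_upwards [hae] with ω hω; rcases hω with h | h <;> simp [h, ha.le]) hmean
    refine h.of_coe_eq ?_
    push_cast
    rw [Real.norm_of_nonneg (by linarith), Real.norm_of_nonneg ha.le]
    ring
  · rw [variance_of_integral_eq_zero hX hmean]
    have heq : (fun ω => X ω ^ 2) =ᵐ[μ] fun _ => a ^ 2 := by
      filter_upwards [hae] with ω hω
      rcases hω with h | h <;> simp [h]
    rw [integral_congr_ae heq]
    simp

/-- Moments of the entries of a rescaled Gaussian or Rademacher matrix. -/
theorem rescaled_entry_moments [IsProbabilityMeasure μ] {Θ : Ω → Matrix (Fin k) (Fin n) ℝ}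
    (hk : 0 < k) (hΘ : IsRescaledGaussian Θ μ ∨ IsRescaledRademacher Θ μ) (i : Fin k) (j : Fin n) :
    HasSubgaussianMGF (fun ω => Θ ω i j) ((k : ℝ≥0)⁻¹) μ ∧ ∫ ω, Θ ω i j ∂μ = 0 ∧
      Var[fun ω => Θ ω i j; μ] = (k : ℝ)⁻¹ := by
  rcases hΘ with h | h
  · have hlaw := h.2 i j
    refine ⟨⟨fun t => ?_, fun t => ?_⟩, ?_, ?_⟩
    · have := integrable_exp_mul_gaussianReal (μ := 0) (v := (k : ℝ≥0)⁻¹) t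
      rw [← hlaw.map_eq] at this
      exact this.comp_aemeasurable hlaw.aemeasurable
    · rw [mgf_gaussianReal hlaw.map_eq]
      simp
    · rw [hlaw.integral_eq]
      simp
    · rw [hlaw.variance_eq, variance_id_gaussianReal]
      simp
  · obtain ⟨hm, hpos, hneg⟩ := h.2 i j
    have hk' : (0 : ℝ) < k := Nat.cast_pos.2 hk
    have h := rademacher_moments (inv_pos.2 (Real.sqrt_pos.2 hk')) hm hpos hneg
    have hsq : (√(k : ℝ))⁻¹ ^ 2 = (k : ℝ)⁻¹ := by rw [inv_pow, Real.sq_sqrt hk'.le]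
    refine ⟨h.1.of_coe_eq ?_, h.2.1, h.2.2.trans hsq⟩
    push_cast
    rw [Real.norm_eq_abs, sq_abs, hsq]

end Entries

/-! ### Union bound over the net and conclusion. -/

section SubspaceEmbedding

variable {Ω : Type*} [MeasurableSpace Ω] {μ : Measure Ω} [IsProbabilityMeasure μ] {k n : ℕ}

theorem pos_of_sample_bound {ε δ D : ℝ} (hε : 0 < ε) (hδ : 0 < δ) (hδ' : δ < 1) (hD : 0 ≤ D)
    (h : 7.87 * ε⁻¹ ^ 2 * (D + Real.log (1 / δ)) ≤ (k : ℝ)) : 0 < k := by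
  have hlog : 0 < Real.log (1 / δ) := Real.log_pos ((one_lt_div hδ).2 hδ')
  have : (0 : ℝ) < k := lt_of_lt_of_le (by positivity) h
  exact_mod_cast this

/-- The union bound over a net of the sphere of an `m`-dimensional space. -/
theorem net_union_bound {ε δ : ℝ} (hε : 0 < ε) (hδ : 0 < δ) {m D : ℕ} (hm : 0 < m) (hmD : m ≤ D)
    (h : 7.87 * ε⁻¹ ^ 2 * (6.9 * (D : ℝ) + Real.log (1 / δ)) ≤ (k : ℝ)) :
    201 ^ m * (2 * Real.exp (-(0.133 * (0.98 * ε) ^ 2 * k))) ≤ δ := by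
  -- The constant 7.87 enters here: `7.87 · 0.133 · 0.98² ≈ 1.005 ≥ 1`.
  have hk : 6.9 * (m : ℝ) + Real.log (1 / δ) ≤ 0.133 * (0.98 * ε) ^ 2 * k := by
    have hmD' : (m : ℝ) ≤ D := Nat.cast_le.2 hmD
    have h1 : 7.87 * (6.9 * (D : ℝ) + Real.log (1 / δ)) ≤ ε ^ 2 * k := by
      have := mul_le_mul_of_nonneg_left h (sq_nonneg ε)
      calc _ = ε ^ 2 * (7.87 * ε⁻¹ ^ 2 * (6.9 * (D : ℝ) + Real.log (1 / δ))) := by field_simp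
        _ ≤ _ := this
    have h2 : 0 ≤ ε ^ 2 * (k : ℝ) := by positivity
    nlinarith
  have hexp : Real.exp (-(0.133 * (0.98 * ε) ^ 2 * k)) ≤ (Real.exp 6.9 ^ m)⁻¹ * δ := by
    calc _ ≤ Real.exp (-(6.9 * (m : ℝ) + Real.log (1 / δ))) := by gcongr
      _ = _ := by
        rw [neg_add, Real.exp_add, Real.exp_neg, mul_comm, one_div, Real.log_inv, neg_neg,
          Real.exp_log hδ, ← Real.exp_nat_mul, mul_comm (m : ℝ), mul_comm]
  -- The two-sided factor 2 is absorbed into `2 ^ m`, which needs `m ≥ 1`; dimension zero is treated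
  -- apart, with an empty net.
  have hpow : 201 ^ m * 2 ≤ Real.exp 6.9 ^ m := by
    calc (201 : ℝ) ^ m * 2 ≤ 201 ^ m * 2 ^ m := by
          gcongr
          exact le_self_pow₀ one_le_two hm.ne'
      _ = 402 ^ m := by rw [← mul_pow]; norm_num
      _ ≤ _ := by gcongr; exact le_exp_six_point_nine
  calc _ ≤ 201 ^ m * (2 * ((Real.exp 6.9 ^ m)⁻¹ * δ)) := by gcongr
    _ = (201 ^ m * 2) * (Real.exp 6.9 ^ m)⁻¹ * δ := by ring
    _ ≤ Real.exp 6.9 ^ m * (Real.exp 6.9 ^ m)⁻¹ * δ := by gcongr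
    _ = δ := by rw [mul_inv_cancel₀ (by positivity), one_mul]

/-- With probability at least `1 - δ`, a rescaled Gaussian or Rademacher matrix nearly preserves
inner products on a real subspace of dimension at most `D`. -/
theorem one_sub_le_measureReal_embeddingDefect_le {D : ℕ} {ε δ : ℝ} (hε : 0 < ε)
    (hε' : ε < 0.572) (hδ : 0 < δ) (hδ' : δ < 1) {Θ : Ω → Matrix (Fin k) (Fin n) ℝ}
    (hΘ : IsRescaledGaussian Θ μ ∨ IsRescaledRademacher Θ μ)
    (hk : 7.87 * ε⁻¹ ^ 2 * (6.9 * (D : ℝ) + Real.log (1 / δ)) ≤ (k : ℝ))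
    (W : Submodule ℝ (EuclideanSpace ℝ (Fin n))) (hW : Module.finrank ℝ W ≤ D) :
    1 - δ ≤ μ.real {ω | ∀ a ∈ W, ∀ b ∈ W, |embeddingDefect (Θ ω) a b| ≤ ε * ‖a‖ * ‖b‖} := by
  have hk0 : 0 < k := pos_of_sample_bound hε hδ hδ' (by positivity) hk
  have hind : iIndepFun (fun (p : Fin k × Fin n) ω => Θ ω p.1 p.2) μ := by
    rcases hΘ with h | h <;> exact h.1
  have hmom := rescaled_entry_moments hk0 hΘ
  obtain ⟨N, hN1, hNcard, hN⟩ := exists_sphere_net (F := W) (γ := 1 / 100) (by norm_num)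
  have hη1 : 0.98 * ε ≤ 0.561 := by linarith
  have htail : ∀ y ∈ N, μ.real {ω | 0.98 * ε ≤ |embeddingDefect (Θ ω) y y|} ≤
      2 * Real.exp (-(0.133 * (0.98 * ε) ^ 2 * k)) := fun y hy =>
    measureReal_embeddingDefect_ge_le hk0 hind (fun i j => (hmom i j).1) (fun i j => (hmom i j).2.1)
      (fun i j => (hmom i j).2.2) (hN1 y hy) (by positivity) hη1
  have hbad : μ.real (⋃ y ∈ N, {ω | 0.98 * ε ≤ |embeddingDefect (Θ ω) y y|}) ≤ δ := by
    rcases Nat.eq_zero_or_pos (Module.finrank ℝ W) with h0 | h0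
    · have : N = ∅ := by
        have := Module.finrank_zero_iff.1 h0
        refine Finset.eq_empty_of_forall_notMem fun y hy => ?_
        have := hN1 y hy
        simp [Subsingleton.elim y 0] at this
      simp [this, hδ.le]
    · refine (measureReal_biUnion_finset_le _ _).trans ((Finset.sum_le_sum htail).trans ?_)
      rw [Finset.sum_const, nsmul_eq_mul]
      norm_num at hNcard
      exact (mul_le_mul_of_nonneg_right hNcard (by positivity)).trans
        (net_union_bound hε hδ h0 hW hk)
  -- Covering the whole space and using subadditivity bounds the good event from below without its
  -- measurability.
  have hcover : Set.univ ⊆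
      {ω | ∀ a ∈ W, ∀ b ∈ W, |embeddingDefect (Θ ω) a b| ≤ ε * ‖a‖ * ‖b‖} ∪
        ⋃ y ∈ N, {ω | 0.98 * ε ≤ |embeddingDefect (Θ ω) y y|} := by
    intro ω _
    by_cases hω : ω ∈ ⋃ y ∈ N, {ω | 0.98 * ε ≤ |embeddingDefect (Θ ω) y y|}
    · exact Or.inr hω
    · left
      simp only [Set.mem_iUnion, Set.mem_ofPred_eq, not_exists, not_le] at hω
      intro a ha b hb
      have h := abs_embeddingDefect_le_of_net (Θ ω) W (N := (N : Set W)) (γ := 1 / 100)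
        (by norm_num) hN1 hN (fun y hy => (hω y hy).le) ha hb
      have hc : 0.98 * ε / (1 - 2 * (1 / 100)) = ε := by ring
      rwa [hc] at h
  have := (measureReal_mono (μ := μ) hcover).trans (measureReal_union_le _ _)
  rw [probReal_univ] at this
  linarith

end SubspaceEmbedding

theorem mainTheorem2 {Ω : Type*} [MeasurableSpace Ω] (μ : Measure Ω) [IsProbabilityMeasure μ]
    (k n d : ℕ) (ε δ : ℝ) (hε : 0 < ε) (hε' : ε < 0.572) (hδ : 0 < δ) (hδ' : δ < 1)
    (Θ : Ω → Matrix (Fin k) (Fin n) ℝ)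
    (hΘ : IsRescaledGaussian Θ μ ∨ IsRescaledRademacher Θ μ) :
    (7.87 * ε⁻¹ ^ 2 * (6.9 * (d : ℝ) + Real.log (1 / δ)) ≤ (k : ℝ) →
      IsObliviousSubspaceEmbedding ε δ d Θ μ) ∧
    (7.87 * ε⁻¹ ^ 2 * (13.8 * (d : ℝ) + Real.log (1 / δ)) ≤ (k : ℝ) →
      IsObliviousSubspaceEmbedding ε δ d
        (fun ω => (Θ ω).map (fun t : ℝ => (t : ℂ))) μ) := by
  have hε1 : ε < 1 := by linarith
  constructor
  · intro hk V hV
    refine (one_sub_le_measureReal_embeddingDefect_le hε hε' hδ hδ' hΘ hk V hV.le).trans ?_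
    exact measureReal_mono fun ω hω => ⟨hε.le, hε1, fun x hx y hy => hω x hx y hy⟩
  · intro hk V hV
    -- The constant 13.8 is `6.9 · 2`, for a real subspace of dimension at most `2d`.
    have hk' : 7.87 * ε⁻¹ ^ 2 * (6.9 * ((2 * d : ℕ) : ℝ) + Real.log (1 / δ)) ≤ (k : ℝ) := by
      convert hk using 3
      push_cast
      ring
    refine (one_sub_le_measureReal_embeddingDefect_le hε hε' hδ hδ' hΘ hk'
      ((V.restrictScalars ℝ).map (euclideanRe n)) (hV ▸ finrank_map_euclideanRe_le V)).trans ?_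
    exact measureReal_mono fun ω hω =>
      ⟨hε.le, hε1, fun x hx y hy => norm_complex_defect_le (Θ ω) V hε.le hω hx hy⟩
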